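/- Monoids are commutative and cancellative. For a monoid $H$ let $\mathsf q(H)\supset H$ be its quotient group, $\widetilde H=\{x\in\mathsf q(H): x^n\in H\text{ for some }n\ge 1\}$ its root closure and $\widehat H=\{x\in \mathsf q(H): \text{there is } c\in H\text{ with }cx^n\in H\text{ for all }n\ge 1\}$ its complete integral closure; $H$ is root closed if $H=\widetilde H$, Krull if $H=\widehat H$ and $H$ satisfies the ascending chain condition on divisorial ideals (the sets $A\subset H$ with $(A^{-1})^{-1}=A$, where $A^{-1}=\{x\in\mathsf q(H): xA\subset H\}$), and factorial if every non-unit is a product of finitely many primes. $H$ is a C-monoid if it is a submonoid of a factorial monoid $F$ with $H\cap F^\times=H^\times$ such that the elements of $(F\setminus F^\times)\cup\{1\}$ fall into finitely many classes for the relation $y\sim y'\Leftrightarrow\{z\in F: yz\in H\}=\{z\in F:y'z\in H\}$. A monoid homomorphism $\varphi:H\to D$ is a divisor homomorphism if $\varphi(a)\mid\varphi(b)$ implies $a\mid b$, and cofinal if every element of $D$ divides some $\varphi(a)$; its class group is $\mathsf q(D)/\mathsf q(\varphi(H))$. A submonoid $H\subset D$ is cofinal (saturated) if its embedding is cofinal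 (a divisor homomorphism), and $D/H$ denotes the monoid of classes $[a]=a\,\mathsf q(H)$, $a\in D$, in $\mathsf q(D)/\mathsf q(H)$. A divisor theory of $H$ is a divisor homomorphism $\varphi$ from $H$ to a free abelian monoid $\mathcal F(P)$ with basis $P$ such that every $p\in P$ is the greatest common divisor of $\varphi(X)$ for some finite nonempty $X\subset H$. The class group $\mathcal C(H)$ of a Krull monoid $H$ is the class group of a divisor theory $H\to\mathcal F(P)$, and the elements of $P$ are the prime divisors. Let $G$ be a finite group, $G_0\subset G$ a subset, and $G'$ the commutator subgroup of $\langle G_0\rangle$. Let $\mathcal F(G_0)$ be the free abelian monoid with basis $G_0$, whose elements are the sequences (finite, unordered, repetition allowed) over $G_0$. For a sequence $S$ let $\pi(S)\subset G$ be the set of products of the terms of $S$ in all possible orders (with $\pi(1)=\{1_G\}$), and let $\mathcal B(G_0)=\{S\in\mathcal F(G_0): 1_G\in\pi(S)\}$ be the monoid of product-one sequences over $G_0$. 1. $\mathcal B(G_0)\subset\mathcal F(G_0)$ is cofinal and $\mathcal B(G_0)$ is a finitely generated C-monoid. $\widetilde{\mathcal B(G_0)}=\widehat{\mathcal B(G_0)}$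 is a finitely generated Krull monoid, it is contained in $\mathcal F(G_0)$, and the embedding $\widehat{\mathcal B(G_0)}\hookrightarrow\mathcal F(G_0)$ is a cofinal divisor homomorphism with class group $\mathcal F(G_0)/\mathcal B(G_0)$. The map $$\Phi:\mathcal F(G_0)/\mathcal B(G_0)\to\langle G_0\rangle/G',\qquad [S]\mapsto gG'\quad\text{for any } g\in\pi(S),$$ is a well-defined group epimorphism. Suppose that $G_0=G$. Then $\Phi$ is an isomorphism, every class of $\mathcal C(\widehat{\mathcal B(G)})$ contains a prime divisor, and if $|G|\ne 2$, then $\widehat{\mathcal B(G)}\hookrightarrow\mathcal F(G)$ is a divisor theory. 2. The following are equivalent: (a) $\mathcal B(G_0)$ is a Krull monoid; (b) $\mathcal B(G_0)$ is root closed; (c) $\mathcal B(G_0)\subset\mathcal F(G_0)$ is saturated. 3. $\mathcal B(G)$ is a Krull monoid if and only if $G$ is abelian. 4. $\mathcal B(G)$ is factorial if and only if $|G|\le 2$. -/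

import Mathlib

universe u v

namespace ProductOne

/-! Monoids are commutative and cancellative, written multiplicatively. -/

section Monoids

/-- The quotient group of `H`. -/
abbrev Q (H : Type u) [CommMonoid H] : Type u := Algebra.GrothendieckGroup H

/-- The canonical map `H → q(H)`; it is injective because `H` is cancellative. -/
abbrev toQ (H : Type u) [CommMonoid H] : H →* Q H := Algebra.GrothendieckGroup.of

/-- The homomorphism `q(H) → q(D)` induced by a monoid homomorphism `φ : H → D`. -/
noncomputable def mapQ {H : Type u} {D : Type v} [CommMonoid H] [CommMonoid D] (φ : H →* D) :
    Q H →* Q D :=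
  Algebra.GrothendieckGroup.lift ((toQ D).comp φ)

/-- `H` as a submonoid of its quotient group. -/
noncomputable def imageQ (H : Type u) [CommMonoid H] : Submonoid (Q H) := MonoidHom.mrange (toQ H)

/-- The root closure of `H`: all `x ∈ q(H)` with `x ^ n ∈ H` for some `n ≥ 1`. -/
noncomputable def rootClosure (H : Type u) [CommMonoid H] : Submonoid (Q H) where
  carrier := {x | ∃ n : ℕ, 1 ≤ n ∧ x ^ n ∈ imageQ H}
  one_mem' := ⟨1, le_rfl, by simp [one_mem]⟩
  mul_mem' := by
    rintro x y ⟨m, hm, hx⟩ ⟨n, hn, hy⟩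
    refine ⟨m * n, Nat.mul_pos hm hn, ?_⟩
    rw [mul_pow]
    refine mul_mem ?_ ?_
    · rw [pow_mul]; exact pow_mem hx n
    · rw [mul_comm m n, pow_mul]; exact pow_mem hy m

/-- The complete integral closure of `H`: all `x ∈ q(H)` for which there is `c ∈ H` with
`c * x ^ n ∈ H` for all `n ≥ 1`. -/
noncomputable def completeIntClosure (H : Type u) [CommMonoid H] : Submonoid (Q H) where
  carrier := {x | ∃ c ∈ imageQ H, ∀ n : ℕ, 1 ≤ n → c * x ^ n ∈ imageQ H}
  one_mem' := ⟨1, one_mem _, fun n _ => by simp [one_mem]⟩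
  mul_mem' := by
    rintro x y ⟨c, hc, hx⟩ ⟨d, hd, hy⟩
    refine ⟨c * d, mul_mem hc hd, fun n hn => ?_⟩
    rw [mul_pow, mul_mul_mul_comm]
    exact mul_mem (hx n hn) (hy n hn)

/-- `H` is root closed. -/
def IsRootClosed (H : Type u) [CommMonoid H] : Prop := rootClosure H = imageQ H

/-- `H` is completely integrally closed. -/
def IsCompletelyIntegrallyClosed (H : Type u) [CommMonoid H] : Prop :=
  completeIntClosure H = imageQ H

/-- `A⁻¹ = (H : A) = {x ∈ q(H) : x A ⊆ H}` for a subset `A` of `q(H)`. -/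
def idealInv {H : Type u} [CommMonoid H] (A : Set (Q H)) : Set (Q H) :=
  {x | ∀ a ∈ A, x * a ∈ imageQ H}

/-- The `v`-ideals of `H`: the subsets `A` of `H` with `A_v = (A⁻¹)⁻¹ = A`. -/
def IsVIdeal {H : Type u} [CommMonoid H] (A : Set (Q H)) : Prop :=
  A ⊆ imageQ H ∧ idealInv (idealInv A) = A

/-- `H` is `v`-noetherian: it satisfies the ascending chain condition on `v`-ideals. -/
def IsVNoetherian (H : Type u) [CommMonoid H] : Prop :=
  ∀ A : ℕ → Set (Q H), (∀ n, IsVIdeal (A n)) → Monotone A → ∃ m, ∀ n, m ≤ n → A n = A m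

/-- Krull monoids: `v`-noetherian and completely integrally closed. -/
def IsKrull (H : Type u) [CommMonoid H] [IsCancelMul H] : Prop :=
  IsVNoetherian H ∧ IsCompletelyIntegrallyClosed H

/-- Prime elements of a monoid without zero. -/
def IsPrimeElement {H : Type u} [CommMonoid H] (p : H) : Prop :=
  ¬ IsUnit p ∧ ∀ a b : H, p ∣ a * b → p ∣ a ∨ p ∣ b

/-- Factorial monoids: every non-unit is a product of finitely many primes. -/
def IsFactorial (H : Type u) [CommMonoid H] [IsCancelMul H] : Prop :=
  ∀ a : H, ¬ IsUnit a → ∃ s : Multiset H, (∀ p ∈ s, IsPrimeElement p) ∧ s.prod = a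

variable {H : Type u} {D : Type v} [CommMonoid H] [CommMonoid D]

/-- Divisor homomorphisms. -/
def IsDivisorHom (φ : H →* D) : Prop := ∀ a b : H, φ a ∣ φ b → a ∣ b

/-- Cofinal homomorphisms. -/
def IsCofinalHom (φ : H →* D) : Prop := ∀ d : D, ∃ a : H, d ∣ φ a

/-- A submonoid `H ⊆ D` is saturated if its embedding is a divisor homomorphism. -/
def IsSaturated (H : Submonoid D) : Prop := IsDivisorHom H.subtype

/-- The subgroup `q(φ(H))` of `q(D)`, generated by the image of `φ(H)`. -/
def subQ (φ : H →* D) : Subgroup (Q D) := Subgroup.closure (Set.range fun a => toQ D (φ a))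

/-- The class group `C(φ) = q(D) / q(φ(H))` of a monoid homomorphism `φ : H → D`. -/
abbrev ClassGroupHom (φ : H →* D) : Type v := Q D ⧸ subQ φ

/-- The homomorphism `D → C(φ)`, `a ↦ [a]`. -/
def toClass (φ : H →* D) : D →* ClassGroupHom φ := (QuotientGroup.mk' (subQ φ)).comp (toQ D)

/-- The monoid of classes `{[a] : a ∈ D} ⊆ C(φ)`, written `D/H` if `φ` is an embedding
`H ⊆ D`. -/
def classMonoid (φ : H →* D) : Submonoid (ClassGroupHom φ) := MonoidHom.mrange (toClass φ)

/-- `y, y' ∈ D` are equivalent with respect to `φ : H → D` if `y⁻¹H ∩ D = y'⁻¹H ∩ D`, where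
`y⁻¹H ∩ D = {z ∈ D : y z ∈ H}` and `H` stands for its image in `D`. -/
def classSetoid (φ : H →* D) : Setoid D where
  r y y' := {z : D | y * z ∈ Set.range φ} = {z : D | y' * z ∈ Set.range φ}
  iseqv := ⟨fun _ => rfl, fun h => h.symm, fun h₁ h₂ => h₁.trans h₂⟩

/-- The (underlying set of the) reduced class semigroup `C*(H, D)`: the classes of the elements
of `(D ∖ Dˣ) ∪ {1}`. -/
def reducedClassSemigroup (φ : H →* D) : Set (Quotient (classSetoid φ)) :=
  Quotient.mk (classSetoid φ) '' {y : D | ¬ IsUnit y ∨ y = 1}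

end Monoids

/-- C-monoids: `H` is (via `i`) a submonoid of a factorial monoid `F` with `H ∩ Fˣ = Hˣ`, and
the reduced class semigroup `C*(H, F)` is finite. -/
def IsCMonoid (H : Type u) [CommMonoid H] [IsCancelMul H] : Prop :=
  ∃ (F : Type u) (_ : CommMonoid F) (_ : IsCancelMul F) (i : H →* F),
    IsFactorial F ∧ Function.Injective i ∧ (∀ h : H, IsUnit (i h) → IsUnit h) ∧
      (reducedClassSemigroup i).Finite

/-- The free abelian monoid with basis `P`, realized as the finite multisets on `P`. -/
abbrev Free (P : Type u) : Type u := Multiplicative (Multiset P)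

/-- The basis element of `Free P` given by `p`. -/
def Free.of {P : Type u} (p : P) : Free P := Multiplicative.ofAdd {p}

/-- `d` is a greatest common divisor of the set `X`. -/
def IsGcdOf {D : Type u} [CommMonoid D] (d : D) (X : Set D) : Prop :=
  (∀ x ∈ X, d ∣ x) ∧ ∀ e : D, (∀ x ∈ X, e ∣ x) → e ∣ d

/-- Divisor theories `φ : H → F(P)`: divisor homomorphisms such that every `p ∈ P` is the greatest
common divisor of `φ(X)` for some finite nonempty `X ⊆ H`. -/
def IsDivisorTheory {H : Type u} {P : Type v} [CommMonoid H] (φ : H →* Free P) : Prop :=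
  IsDivisorHom φ ∧ ∀ p : P, ∃ X : Set H, X.Finite ∧ X.Nonempty ∧ IsGcdOf (Free.of p) (φ '' X)

/-- Every class of `C(φ)` contains an element of the basis `P`. -/
def EveryClassContainsPrime {H : Type u} {P : Type v} [CommMonoid H] (φ : H →* Free P) : Prop :=
  ∀ c : ClassGroupHom φ, ∃ p : P, toClass φ (Free.of p) = c

section Sequences

variable {G : Type u} [Group G]

/-- The set of products `π(S)` of a sequence `S` over `G₀`: the products in `G` of all orderings of
its terms. -/
def products {G₀ : Set G} (S : Free G₀) : Set G :=
  {g | ∃ l : List G₀, (l : Multiset G₀) = S.toAdd ∧ (l.map Subtype.val).prod = g}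

/-- The monoid `B(G₀)` of product-one sequences over `G₀`, a submonoid of `F(G₀)`. -/
def B (G₀ : Set G) : Submonoid (Free G₀) where
  carrier := {S | (1 : G) ∈ products S}
  one_mem' := ⟨[], by simp, by simp⟩
  mul_mem' := by
    rintro S T ⟨l, hl, hl1⟩ ⟨m, hm, hm1⟩
    refine ⟨l ++ m, ?_, ?_⟩
    · rw [← Multiset.coe_add, hl, hm, toAdd_mul]
    · rw [List.map_append, List.prod_append, hl1, hm1, one_mul]

end Sequences

end ProductOne

open ProductOne

/-! A product-one sequence stays one when it is raised to a power, and `S ^ |G|` is always a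
product-one sequence. So `B(G₀) ⊆ F(G₀)` is cofinal, and an element of the quotient group of
`B(G₀)` lies in the root closure, equivalently in the complete integral closure, iff it lies in
`F(G₀)` (`mem_completeIntClosure_B`). This embeds the closure as a saturated submonoid of a free
abelian monoid with finite basis, which is Krull by Dickson's lemma (`isKrull_of_isDivisorHom`).
The same criterion gives the equivalence of Krull, root closed and saturated (`tfae_isKrull_B`).

The noncommutative input for finite generation and for the finiteness of the reduced class
semigroup is `mem_B_of_pow_card_mul_mem`: if `g` occurs at least `|G| ^ 2` times in `S` and
`g ^ |G| S` is a product-one sequence, then so is `S`. Hence exponents can be reduced until they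
are bounded in terms of `|G|`.

A sequence over `G` has the class of each of its products, so `g ↦ [g]` is a homomorphism from `G`
onto `F(G)/B(G)`; it kills commutators and inverts `Φ` (`classHom_bijective`). In particular every
class contains some `g ∈ G`, which is a prime divisor if `F(G)` belongs to a divisor theory. For
`|G| ≥ 3` it does, as every `g` is the greatest common divisor of `g ^ |G|` and a product-one
sequence containing `g` exactly once (`exists_mem_B_mult_eq_one`). The case `|G| = 1` is trivial,
and for `|G| = 2` the monoid `B(G)` is itself free. The choice of the divisor theory does not
matter, since divisors are described by the `v`-ideals of the monoid
(`IsDivisorTheory.dvd_map_iff`). -/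

namespace ProductOne

/-! ### Quotient groups -/

section Quotient

variable {H : Type u} {D : Type v} [CommMonoid H] [CommMonoid D]

theorem toQ_injective [IsCancelMul H] : Function.Injective (toQ H) :=
  Algebra.GrothendieckGroup.of_injective

theorem exists_eq_div (x : Q H) : ∃ a b : H, x = toQ H a / toQ H b := by
  obtain ⟨⟨a, b⟩, h⟩ := (Localization.monoidOf (⊤ : Submonoid H)).surj x
  exact ⟨a, b, eq_div_of_mul_eq' h⟩

@[simp]
theorem mapQ_toQ (φ : H →* D) (a : H) : mapQ φ (toQ H a) = toQ D (φ a) :=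
  DFunLike.congr_fun (Algebra.GrothendieckGroup.lift.symm_apply_apply ((toQ D).comp φ)) a

theorem lift_toQ {A : Type*} [CommGroup A] (f : H →* A) (a : H) :
    Algebra.GrothendieckGroup.lift f (toQ H a) = f a :=
  DFunLike.congr_fun (Algebra.GrothendieckGroup.lift.symm_apply_apply f) a

theorem toQ_mem_imageQ (a : H) : toQ H a ∈ imageQ H := ⟨a, rfl⟩

theorem toQ_div_mem_imageQ [IsCancelMul H] {a b : H} :
    toQ H a / toQ H b ∈ imageQ H ↔ b ∣ a := by
  constructor
  · rintro ⟨c, hc⟩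
    refine ⟨c, toQ_injective ?_⟩
    rw [map_mul, hc, mul_div_cancel]
  · rintro ⟨c, rfl⟩
    exact ⟨c, by rw [map_mul, mul_div_cancel_left]⟩

theorem mapQ_injective [IsCancelMul D] {φ : H →* D} (hφ : Function.Injective φ) :
    Function.Injective (mapQ φ) := by
  rw [injective_iff_map_eq_one]
  intro x hx
  obtain ⟨a, b, rfl⟩ := exists_eq_div x
  rw [map_div, mapQ_toQ, mapQ_toQ, div_eq_one] at hx
  rw [hφ (toQ_injective hx), div_self']

theorem mem_subQ {φ : H →* D} {y : Q D} : y ∈ subQ φ ↔ ∃ x, mapQ φ x = y := by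
  constructor
  · intro hy
    have : subQ φ ≤ (mapQ φ).range := by
      refine (Subgroup.closure_le _).2 ?_
      rintro _ ⟨a, rfl⟩
      exact ⟨toQ H a, mapQ_toQ φ a⟩
    exact this hy
  · rintro ⟨x, rfl⟩
    obtain ⟨a, b, rfl⟩ := exists_eq_div x
    rw [map_div, mapQ_toQ, mapQ_toQ]
    exact div_mem (Subgroup.subset_closure ⟨a, rfl⟩) (Subgroup.subset_closure ⟨b, rfl⟩)

theorem toQ_mem_subQ (φ : H →* D) (a : H) : toQ D (φ a) ∈ subQ φ :=
  Subgroup.subset_closure ⟨a, rfl⟩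

theorem toClass_eq_one {φ : H →* D} {d : D} : toClass φ d = 1 ↔ toQ D d ∈ subQ φ :=
  QuotientGroup.eq_one_iff _

theorem toClass_map (φ : H →* D) (a : H) : toClass φ (φ a) = 1 :=
  toClass_eq_one.2 (toQ_mem_subQ φ a)

/-- If `φ` is cofinal, every class in `C(φ)` is represented by an element of `D`. -/
theorem toClass_surjective {φ : H →* D} (hφ : IsCofinalHom φ) :
    Function.Surjective (toClass φ) := by
  intro c
  obtain ⟨y, rfl⟩ := QuotientGroup.mk_surjective c
  obtain ⟨s, t, rfl⟩ := exists_eq_div y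
  obtain ⟨a, r, hr⟩ := hφ t
  have h : toClass φ t * toClass φ r = 1 := by rw [← map_mul, ← hr, toClass_map]
  refine ⟨s * r, ?_⟩
  rw [map_mul, eq_inv_of_mul_eq_one_right h, ← div_eq_mul_inv]
  rfl

theorem classMonoid_eq_top {φ : H →* D} (hφ : IsCofinalHom φ) : classMonoid φ = ⊤ :=
  MonoidHom.mrange_eq_top.2 (toClass_surjective hφ)

/-- Elements of `D` lie in the same class iff they become equal after multiplication by
elements of `φ(H)`. -/
theorem toClass_eq_iff [IsCancelMul D] {φ : H →* D} {d e : D} :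
    toClass φ d = toClass φ e ↔ ∃ a b : H, d * φ a = e * φ b := by
  constructor
  · intro h
    have h' : toQ D d / toQ D e ∈ subQ φ := by
      rw [← QuotientGroup.eq_one_iff, QuotientGroup.mk_div, div_eq_one]
      exact h
    obtain ⟨x, hx⟩ := mem_subQ.1 h'
    obtain ⟨b, a, rfl⟩ := exists_eq_div x
    rw [map_div, mapQ_toQ, mapQ_toQ, div_eq_div_iff_mul_eq_mul, ← map_mul, ← map_mul] at hx
    refine ⟨a, b, ?_⟩
    rw [mul_comm e, toQ_injective hx]
  · rintro ⟨a, b, h⟩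
    have := congrArg (toClass φ) h
    rwa [map_mul, map_mul, toClass_map, toClass_map, mul_one, mul_one] at this

theorem imageQ_le_rootClosure : imageQ H ≤ rootClosure H :=
  fun x hx => ⟨1, le_rfl, by rwa [pow_one]⟩

theorem rootClosure_le_completeIntClosure : rootClosure H ≤ completeIntClosure H := by
  rintro x ⟨m, hm, hx⟩
  obtain ⟨a, b, rfl⟩ := exists_eq_div x
  refine ⟨toQ H b ^ m, pow_mem (toQ_mem_imageQ b) m, fun n _ => ?_⟩
  -- Writing `n = m q + r` with `r < m`, the product is `((a / b) ^ m) ^ q * b ^ (m - r) * a ^ r`.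
  have hr : n % m ≤ m := (Nat.mod_lt n hm).le
  have key : toQ H b ^ m * (toQ H a / toQ H b) ^ n =
      ((toQ H a / toQ H b) ^ m) ^ (n / m) * (toQ H b ^ (m - n % m) * toQ H a ^ (n % m)) := by
    conv_lhs => rw [← Nat.div_add_mod n m, pow_add, pow_mul, ← Nat.sub_add_cancel hr, pow_add]
    rw [Nat.sub_add_cancel hr, div_pow (toQ H a) (toQ H b) (n % m), mul_mul_mul_comm,
      mul_comm (toQ H b ^ (m - n % m)), mul_assoc, mul_div_cancel]
  rw [key]
  exact mul_mem (pow_mem hx _)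
    (mul_mem (pow_mem (toQ_mem_imageQ b) _) (pow_mem (toQ_mem_imageQ a) _))

theorem imageQ_le_completeIntClosure : imageQ H ≤ completeIntClosure H :=
  imageQ_le_rootClosure.trans rootClosure_le_completeIntClosure

end Quotient

/-! ### Free abelian monoids -/

section FreeMonoid

variable {P : Type u}

open Classical in
/-- The exponent of the basis element `p` in `S`. -/
noncomputable def mult (p : P) (S : Free P) : ℕ := Multiset.count p S.toAdd

@[simp]
theorem mult_mul (p : P) (S T : Free P) : mult p (S * T) = mult p S + mult p T := by
  simp [mult]

@[simp]
theorem mult_one (p : P) : mult p (1 : Free P) = 0 := by simp [mult]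

@[simp]
theorem mult_pow (p : P) (S : Free P) (n : ℕ) : mult p (S ^ n) = n * mult p S := by
  simp [mult]

open Classical in
theorem mult_of (p q : P) : mult p (Free.of q) = if p = q then 1 else 0 := by
  simp [mult, Free.of, Multiset.count_singleton]

@[simp]
theorem mult_of_self (p : P) : mult p (Free.of p) = 1 := by simp [mult_of]

theorem mult_of_ne {p q : P} (h : p ≠ q) : mult p (Free.of q) = 0 := by simp [mult_of, h]

theorem free_ext {S T : Free P} (h : ∀ p, mult p S = mult p T) : S = T := by
  classical
  refine Multiplicative.toAdd.injective (Multiset.ext.2 fun p => ?_)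
  have := h p
  unfold mult at this
  convert this

theorem dvd_iff_mult {S T : Free P} : S ∣ T ↔ ∀ p, mult p S ≤ mult p T := by
  classical
  constructor
  · rintro ⟨R, rfl⟩ p
    simp
  · intro h
    have : S.toAdd ≤ T.toAdd := Multiset.le_iff_count.2 fun p => by
      have := h p
      unfold mult at this
      convert this
    obtain ⟨R, hR⟩ := Multiset.le_iff_exists_add.1 this
    exact ⟨Multiplicative.ofAdd R, Multiplicative.toAdd.injective hR⟩

theorem of_dvd_iff {p : P} {S : Free P} : Free.of p ∣ S ↔ mult p S ≠ 0 := by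
  rw [dvd_iff_mult]
  constructor
  · intro h
    have := h p
    rw [mult_of_self] at this
    omega
  · intro h q
    rcases eq_or_ne q p with rfl | hq
    · rw [mult_of_self]; omega
    · rw [mult_of_ne hq]; omega

theorem exists_of_dvd {S : Free P} (h : S ≠ 1) : ∃ p, Free.of p ∣ S := by
  by_contra! h'
  exact h (free_ext fun p => by simpa [of_dvd_iff] using h' p)

theorem free_induction {C : Free P → Prop} (S : Free P) (one : C 1)
    (of_mul : ∀ p S, C S → C (Free.of p * S)) : C S :=
  Multiset.induction (p := fun s => C (Multiplicative.ofAdd s)) one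
    (fun p _ hs => of_mul p _ hs) S.toAdd

theorem free_dvd_antisymm {S T : Free P} (h : S ∣ T) (h' : T ∣ S) : S = T :=
  free_ext fun p => le_antisymm (dvd_iff_mult.1 h p) (dvd_iff_mult.1 h' p)

theorem eq_one_of_dvd_one {S : Free P} (h : S ∣ 1) : S = 1 :=
  free_dvd_antisymm h (one_dvd S)

theorem isUnit_free_iff {S : Free P} : IsUnit S ↔ S = 1 :=
  ⟨fun h => eq_one_of_dvd_one h.dvd, fun h => h ▸ isUnit_one⟩

theorem of_ne_one (p : P) : Free.of p ≠ 1 := fun h => by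
  have := mult_of_self p
  rw [h, mult_one] at this
  omega

theorem isPrimeElement_of (p : P) : IsPrimeElement (Free.of p) := by
  refine ⟨fun h => of_ne_one p (isUnit_free_iff.1 h), fun a b h => ?_⟩
  rw [of_dvd_iff, mult_mul] at h
  rw [of_dvd_iff, of_dvd_iff]
  omega

theorem isFactorial_free : IsFactorial (Free P) := by
  intro S h
  refine ⟨S.toAdd.map Free.of, ?_, ?_⟩
  · intro q hq
    obtain ⟨p, _, rfl⟩ := Multiset.mem_map.1 hq
    exact isPrimeElement_of p
  · clear h
    induction S using free_induction with
    | one => simp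
    | of_mul p S ih =>
      rw [toAdd_mul, Multiset.map_add, Multiset.prod_add, ih]
      simp [Free.of]

/-- A bounded set in a free abelian monoid with finite basis is finite. -/
theorem finite_setOf_mult_le [Finite P] (N : ℕ) : {S : Free P | ∀ p, mult p S ≤ N}.Finite := by
  refine Set.Finite.of_finite_image (f := fun S p => mult p S) ?_ ?_
  · refine (Set.Finite.pi' fun _ : P => Set.finite_Iic N).subset ?_
    rintro _ ⟨S, hS, rfl⟩
    exact hS
  · intro S _ T _ h
    exact free_ext fun p => congrFun h p

/-- Dickson's lemma: every sequence in a free abelian monoid with finite basis has two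
members of which the earlier divides the later. -/
theorem exists_lt_dvd [Finite P] (f : ℕ → Free P) : ∃ m n, m < n ∧ f m ∣ f n := by
  obtain ⟨m, n, hmn, h⟩ := wellQuasiOrdered_le (α := P → ℕ) (fun k p => mult p (f k))
  exact ⟨m, n, hmn, dvd_iff_mult.2 h⟩

/-- A free abelian monoid is completely integrally closed. -/
theorem dvd_of_forall_pow_dvd {c s t : Free P} (h : ∀ n, 1 ≤ n → t ^ n ∣ c * s ^ n) : t ∣ s := by
  refine dvd_iff_mult.2 fun p => ?_
  have := dvd_iff_mult.1 (h (mult p c + 1) (by omega)) p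
  rw [mult_pow, mult_mul, mult_pow] at this
  by_contra! hlt
  nlinarith

end FreeMonoid

/-! ### Submonoids of free abelian monoids -/

section DivisorHom

variable {H : Type u} {P : Type v} [CommMonoid H]

/-- The complete integral closure of a monoid mapping to a free abelian monoid maps into that
free abelian monoid. -/
theorem mapQ_mem_imageQ_of_mem_completeIntClosure (φ : H →* Free P) {x : Q H}
    (hx : x ∈ completeIntClosure H) : mapQ φ x ∈ imageQ (Free P) := by
  obtain ⟨_, ⟨c, rfl⟩, h⟩ := hx
  obtain ⟨a, b, rfl⟩ := exists_eq_div x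
  rw [map_div, mapQ_toQ, mapQ_toQ, toQ_div_mem_imageQ]
  refine dvd_of_forall_pow_dvd (c := φ c) fun n hn => ?_
  obtain ⟨d, hd⟩ := h n hn
  refine ⟨φ d, toQ_injective ?_⟩
  have := congrArg (mapQ φ) hd
  rw [mapQ_toQ, map_mul, map_pow, map_div, mapQ_toQ, mapQ_toQ, mapQ_toQ] at this
  rw [map_mul, map_mul, map_pow, map_pow, this, div_pow, mul_div, mul_div_cancel]

/-- A monoid with a divisor homomorphism to a free abelian monoid with finite basis is Krull.
Ascending chains of `v`-ideals become stationary by Dickson's lemma. -/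
theorem isKrull_of_isDivisorHom [IsCancelMul H] [Finite P] {φ : H →* Free P}
    (hφ : IsDivisorHom φ) : IsKrull H := by
  refine ⟨fun A hA hmono => ?_, le_antisymm (fun x hx => ?_) imageQ_le_completeIntClosure⟩
  · by_contra! hcon
    have hstep : ∀ m, ∃ n, m ≤ n ∧ ∃ h : H, toQ H h ∈ A n ∧ toQ H h ∉ A m := by
      intro m
      obtain ⟨n, hmn, hne⟩ := hcon m
      obtain ⟨x, hxn, hxm⟩ := Set.exists_of_ssubset ((hmono hmn).ssubset_of_ne (Ne.symm hne))
      obtain ⟨h, rfl⟩ := (hA n).1 hxn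
      exact ⟨n, hmn, h, hxn, hxm⟩
    choose next hle h hmem hnot using hstep
    let k : ℕ → ℕ := fun i => next^[i] 0
    have hk : Monotone k := monotone_nat_of_le_succ fun i => by
      simp only [k, Function.iterate_succ_apply']
      exact hle _
    obtain ⟨m, n, hmn, c, hc⟩ := exists_lt_dvd fun i => φ (h (k i))
    obtain ⟨r, hr⟩ := hφ (h (k m)) (h (k n)) ⟨c, hc⟩
    refine hnot (k n) ?_
    have hm : toQ H (h (k m)) ∈ A (k n) := by
      refine hmono (hk (Nat.succ_le_of_lt hmn)) ?_
      simp only [k, Function.iterate_succ_apply']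
      exact hmem _
    rw [← (hA (k n)).2] at hm ⊢
    intro a ha
    rw [hr, map_mul, mul_right_comm]
    exact mul_mem (hm a ha) (toQ_mem_imageQ r)
  · have := mapQ_mem_imageQ_of_mem_completeIntClosure φ hx
    obtain ⟨a, b, rfl⟩ := exists_eq_div x
    rw [map_div, mapQ_toQ, mapQ_toQ, toQ_div_mem_imageQ] at this
    exact toQ_div_mem_imageQ.2 (hφ _ _ this)

/-- A submonoid of a free abelian monoid with finite basis is finitely generated if each element
either has exponents at most `N` or is a product of two elements different from `1`. -/
theorem fg_of_forall_mult_le [Finite P] {φ : H →* Free P} (hφ : Function.Injective φ) (N : ℕ)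
    (h : ∀ a : H, (∀ p, mult p (φ a) ≤ N) ∨ ∃ b c : H, a = b * c ∧ b ≠ 1 ∧ c ≠ 1) :
    Monoid.FG H := by
  refine (Monoid.fg_iff).2 ⟨{a | ∀ p, mult p (φ a) ≤ N}, ?_, ?_⟩
  · rw [eq_top_iff]
    rintro a -
    induction hn : Multiset.card (φ a).toAdd using Nat.strong_induction_on generalizing a with
    | _ n ih =>
      rcases h a with ha | ⟨b, c, rfl, hb, hc⟩
      · exact Submonoid.subset_closure ha
      · have hpos : ∀ d : H, d ≠ 1 → 0 < Multiset.card (φ d).toAdd := fun d hd => by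
          rw [Multiset.card_pos]
          intro h0
          exact hd (hφ ((Multiplicative.toAdd.injective h0).trans (map_one φ).symm))
        have hb' := hpos b hb
        have hc' := hpos c hc
        rw [map_mul, toAdd_mul, Multiset.card_add] at hn
        exact mul_mem (ih _ (by omega) rfl) (ih _ (by omega) rfl)
  · exact ((finite_setOf_mult_le N).preimage hφ.injOn)

end DivisorHom

/-! ### Product-one sequences -/

section Sequences

variable {G : Type u} [Group G] {G₀ : Set G}

theorem mem_B {S : Free G₀} : S ∈ B G₀ ↔ (1 : G) ∈ products S := Iff.rfl

theorem products_nonempty (S : Free G₀) : (products S).Nonempty :=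
  ⟨_, S.toAdd.toList, Multiset.coe_toList _, rfl⟩

theorem one_mem_products : (1 : G) ∈ products (1 : Free G₀) := ⟨[], rfl, rfl⟩

theorem mul_mem_products {S T : Free G₀} {g h : G} (hg : g ∈ products S) (hh : h ∈ products T) :
    g * h ∈ products (S * T) := by
  obtain ⟨l, hl, rfl⟩ := hg
  obtain ⟨m, hm, rfl⟩ := hh
  exact ⟨l ++ m, by rw [← Multiset.coe_add, hl, hm, toAdd_mul], by simp⟩

theorem pow_mem_products {S : Free G₀} {g : G} (hg : g ∈ products S) (n : ℕ) :
    g ^ n ∈ products (S ^ n) := by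
  induction n with
  | zero => simpa using one_mem_products
  | succ n ih =>
    rw [pow_succ, pow_succ]
    exact mul_mem_products ih hg

theorem mem_products_of (g : G₀) : (g : G) ∈ products (Free.of g) := ⟨[g], rfl, by simp⟩

theorem of_pow_mem_B_iff {g : G₀} {n : ℕ} : Free.of g ^ n ∈ B G₀ ↔ (g : G) ^ n = 1 := by
  constructor
  · rintro ⟨l, hl, hl1⟩
    have : l = List.replicate n g := by
      rw [List.eq_replicate_iff]
      have hl' : (l : Multiset G₀) = Multiset.replicate n g := by
        rw [hl, Free.of, toAdd_pow, toAdd_ofAdd, Multiset.nsmul_singleton]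
      refine ⟨by simpa using congrArg Multiset.card hl', fun b hb => ?_⟩
      exact Multiset.eq_of_mem_replicate (hl' ▸ Multiset.mem_coe.2 hb)
    simpa [this] using hl1
  · intro h
    rw [mem_B, ← h]
    exact pow_mem_products (mem_products_of g) n

theorem products_subset_closure {S : Free G₀} {g : G} (hg : g ∈ products S) :
    g ∈ Subgroup.closure G₀ := by
  obtain ⟨l, -, rfl⟩ := hg
  refine list_prod_mem fun x hx => ?_
  obtain ⟨y, -, rfl⟩ := List.mem_map.1 hx
  exact Subgroup.subset_closure y.2

/-- A homomorphism from `⟨G₀⟩` to an abelian group takes the same value on all products of a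
sequence. -/
theorem map_products {A : Type*} [CommMonoid A] (f : Subgroup.closure G₀ →* A) {S : Free G₀} {g : G}
    (hg : g ∈ products S) :
    f ⟨g, products_subset_closure hg⟩ =
      (S.toAdd.map fun x : G₀ => f ⟨x, Subgroup.subset_closure x.2⟩).prod := by
  obtain ⟨l, hl, rfl⟩ := hg
  have hprod : (⟨(l.map Subtype.val).prod, products_subset_closure ⟨l, hl, rfl⟩⟩ :
      Subgroup.closure G₀) =
      (l.map fun x : G₀ => ⟨(x : G), Subgroup.subset_closure x.2⟩).prod := by
    apply Subtype.ext
    rw [SubmonoidClass.coe_list_prod, List.map_map]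
    rfl
  rw [hprod, map_list_prod, List.map_map]
  simp only [← hl, Multiset.map_coe, Multiset.prod_coe]
  rfl

theorem pow_card_mem_B (S : Free G₀) : S ^ Nat.card G ∈ B G₀ := by
  obtain ⟨g, hg⟩ := products_nonempty S
  have := pow_mem_products hg (Nat.card G)
  rwa [pow_card_eq_one'] at this

theorem isCofinalHom_B [Finite G] : IsCofinalHom (B G₀).subtype := fun S =>
  ⟨⟨S ^ Nat.card G, pow_card_mem_B S⟩, dvd_pow_self S Nat.card_pos.ne'⟩

/-! ### Removing repeated terms -/

open Classical in
/-- The number of occurrences of `g` in the word `l` for which the product of all preceding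
letters equals `p`. -/
noncomputable def visits (g : G₀) : G → List G₀ → ℕ
  | _, [] => 0
  | p, x :: l => (if x = g ∧ p = 1 then 1 else 0) + visits g ((x : G)⁻¹ * p) l

theorem sum_visits [Fintype G] (g : G₀) (l : List G₀) :
    ∑ p, visits g p l = mult g (Multiplicative.ofAdd (l : Multiset G₀)) := by
  classical
  induction l with
  | nil => simp [visits, mult]
  | cons x l ih =>
    have hx : ∑ p, visits g ((x : G)⁻¹ * p) l = ∑ p, visits g p l :=
      Equiv.sum_comp (Equiv.mulLeft (x : G)⁻¹) fun p => visits g p l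
    simp only [visits, Finset.sum_add_distrib, hx, ih]
    have hm : Multiplicative.ofAdd ((x :: l : List G₀) : Multiset G₀) =
        Free.of x * Multiplicative.ofAdd (l : Multiset G₀) := rfl
    rw [hm, mult_mul, mult_of]
    by_cases h : x = g
    · simp [h]
    · simp [h, Ne.symm h]

/-- Deleting `k` occurrences of `g` whose preceding letters have product `p` multiplies the
product of the word by `p g⁻ᵏ p⁻¹` from the left. -/
theorem exists_delete_of_le_visits (g : G₀) (l : List G₀) (p : G) (k : ℕ) (hk : k ≤ visits g p l) :
    ∃ m : List G₀, (l : Multiset G₀) = Multiset.replicate k g + m ∧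
      (m.map Subtype.val).prod = p * ((g : G) ^ k)⁻¹ * p⁻¹ * (l.map Subtype.val).prod := by
  induction l generalizing p k with
  | nil =>
    obtain rfl : k = 0 := by simpa [visits] using hk
    exact ⟨[], by simp, by simp⟩
  | cons x l ih =>
    rw [visits] at hk
    by_cases h : x = g ∧ p = 1 ∧ k ≠ 0
    · obtain ⟨rfl, rfl, h0⟩ := h
      obtain ⟨k, rfl⟩ := Nat.exists_eq_succ_of_ne_zero h0
      rw [if_pos ⟨rfl, rfl⟩] at hk
      obtain ⟨m, hm, hmp⟩ := ih ((x : G)⁻¹ * 1) k (by omega)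
      refine ⟨m, ?_, ?_⟩
      · rw [← Multiset.cons_coe, hm, Nat.succ_eq_add_one, Multiset.replicate_succ,
          Multiset.cons_add]
      · rw [hmp, List.map_cons, List.prod_cons, pow_succ]
        group
    · have hk' : k ≤ visits g ((x : G)⁻¹ * p) l := by
        by_cases hc : x = g ∧ p = 1
        · have : k = 0 := by
            by_contra h0
            exact h ⟨hc.1, hc.2, h0⟩
          omega
        · rwa [if_neg hc, zero_add] at hk
      obtain ⟨m, hm, hmp⟩ := ih _ k hk'
      refine ⟨x :: m, ?_, ?_⟩
      · rw [← Multiset.cons_coe, hm, ← Multiset.cons_coe, Multiset.add_cons]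
      · rw [List.map_cons, List.prod_cons, hmp, List.map_cons, List.prod_cons]
        group

variable [Finite G]

/-- If `g` occurs often enough in `S`, then `g ^ |G|` can be cancelled from a product-one
sequence `g ^ |G| S`: by the pigeonhole principle there is an ordering of the latter with product
one in which `|G|` occurrences of `g` are preceded by the same product `p`, and deleting these
multiplies the product by `p g ^ (-|G|) p⁻¹ = 1`. -/
theorem mem_B_of_pow_card_mul_mem {g : G₀} {S : Free G₀} (hS : Nat.card G ^ 2 ≤ mult g S)
    (h : Free.of g ^ Nat.card G * S ∈ B G₀) : S ∈ B G₀ := by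
  have := Fintype.ofFinite G
  obtain ⟨l, hl, hl1⟩ := h
  have hsum := sum_visits g l
  rw [hl, ofAdd_toAdd, mult_mul] at hsum
  obtain ⟨p, hp⟩ : ∃ p, Nat.card G ≤ visits g p l := by
    by_contra! hlt
    have hle : ∑ p, visits g p l < ∑ _p : G, Nat.card G :=
      Finset.sum_lt_sum_of_nonempty ⟨1, Finset.mem_univ _⟩ fun p _ => hlt p
    rw [Finset.sum_const, Finset.card_univ, ← Nat.card_eq_fintype_card, smul_eq_mul, ← sq] at hle
    omega
  obtain ⟨m, hm, hmp⟩ := exists_delete_of_le_visits g l p _ hp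
  refine ⟨m, ?_, ?_⟩
  · rw [hl, toAdd_mul, Free.of, toAdd_pow, toAdd_ofAdd, Multiset.nsmul_singleton] at hm
    exact (add_left_cancel hm).symm
  · rw [hmp, hl1, pow_card_eq_one']
    simp

theorem exists_eq_pow_mul {P : Type v} {p : P} {S : Free P} {n : ℕ} (h : n ≤ mult p S) :
    ∃ T, S = Free.of p ^ n * T := by
  refine dvd_iff_mult.2 fun q => ?_
  rcases eq_or_ne q p with rfl | hq
  · simpa using h
  · simp [mult_of_ne hq]

theorem fg_B : Monoid.FG (B G₀) := by
  refine fg_of_forall_mult_le (φ := (B G₀).subtype) Subtype.val_injective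
    (Nat.card G + Nat.card G ^ 2) fun a => or_iff_not_imp_left.2 fun ha => ?_
  push Not at ha
  obtain ⟨p, hp⟩ := ha
  rw [Submonoid.subtype_apply] at hp
  obtain ⟨T, hT⟩ := exists_eq_pow_mul (p := p) (S := (a : Free G₀)) (n := Nat.card G) (by omega)
  have hpT : Nat.card G ^ 2 < mult p T := by
    rw [hT, mult_mul, mult_pow, mult_of_self] at hp
    omega
  have hTB : T ∈ B G₀ := mem_B_of_pow_card_mul_mem hpT.le (hT ▸ a.2)
  refine ⟨⟨_, pow_card_mem_B (Free.of p)⟩, ⟨T, hTB⟩, Subtype.ext hT, fun h => ?_, fun h => ?_⟩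
  · have := congrArg (fun x : B G₀ => mult p (x : Free G₀)) h
    simp [Nat.card_pos.ne'] at this
  · have := congrArg (fun x : B G₀ => mult p (x : Free G₀)) h
    simp at this
    omega

theorem isCMonoid_B : IsCMonoid (B G₀) := by
  refine ⟨Free G₀, inferInstance, inferInstance, (B G₀).subtype, isFactorial_free,
    Subtype.val_injective, fun S hS => ?_, ?_⟩
  · have : S = 1 := Subtype.ext (isUnit_free_iff.1 hS)
    exact this ▸ isUnit_one
  · refine ((finite_setOf_mult_le (Nat.card G + Nat.card G ^ 2)).image
      (Quotient.mk (classSetoid (B G₀).subtype))).subset ?_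
    rintro _ ⟨y, -, rfl⟩
    induction hn : Multiset.card y.toAdd using Nat.strong_induction_on generalizing y with
    | _ n ih =>
      by_cases hy : ∀ p, mult p y ≤ Nat.card G + Nat.card G ^ 2
      · exact ⟨y, hy, rfl⟩
      push Not at hy
      obtain ⟨p, hp⟩ := hy
      obtain ⟨T, rfl⟩ := exists_eq_pow_mul (p := p) (S := y) (n := Nat.card G) (by omega)
      have hT : Quotient.mk (classSetoid (B G₀).subtype) (Free.of p ^ Nat.card G * T) =
          Quotient.mk _ T := by
        refine Quotient.sound (Set.ext fun z => ?_)
        simp only [Set.mem_ofPred_eq, Subtype.range_coe_subtype, Submonoid.coe_subtype]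
        rw [mul_assoc]
        refine ⟨fun h => mem_B_of_pow_card_mul_mem ?_ h, fun h => mul_mem (pow_card_mem_B _) h⟩
        rw [mult_mul, mult_pow, mult_of_self] at hp
        rw [mult_mul]
        omega
      rw [hT]
      refine ih _ ?_ T rfl
      rw [← hn, toAdd_mul, Multiset.card_add]
      simp [Free.of, Nat.card_pos]

/-! ### The complete integral closure -/

theorem mem_completeIntClosure_B {x : Q (B G₀)} :
    x ∈ completeIntClosure (B G₀) ↔ mapQ (B G₀).subtype x ∈ imageQ (Free G₀) := by
  refine ⟨mapQ_mem_imageQ_of_mem_completeIntClosure _, fun ⟨S, hS⟩ => ?_⟩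
  refine rootClosure_le_completeIntClosure
    ⟨Nat.card G, Nat.card_pos, ⟨S ^ Nat.card G, pow_card_mem_B S⟩, ?_⟩
  refine mapQ_injective (φ := (B G₀).subtype) Subtype.val_injective ?_
  rw [mapQ_toQ, map_pow, ← hS, Submonoid.subtype_apply, map_pow]

theorem rootClosure_eq_completeIntClosure_B :
    rootClosure (B G₀) = completeIntClosure (B G₀) := by
  refine le_antisymm rootClosure_le_completeIntClosure fun x hx => ?_
  obtain ⟨S, hS⟩ := mem_completeIntClosure_B.1 hx
  refine ⟨Nat.card G, Nat.card_pos, ⟨S ^ Nat.card G, pow_card_mem_B S⟩, ?_⟩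
  refine mapQ_injective (φ := (B G₀).subtype) Subtype.val_injective ?_
  rw [mapQ_toQ, map_pow, ← hS, Submonoid.subtype_apply, map_pow]

variable (G₀) in
/-- The embedding of the complete integral closure of `B(G₀)` into `F(G₀)`. -/
noncomputable def closureEmbedding : completeIntClosure (B G₀) →* Free G₀ where
  toFun x := (mem_completeIntClosure_B.1 x.2).choose
  map_one' := toQ_injective <| by
    rw [(mem_completeIntClosure_B.1 (1 : completeIntClosure (B G₀)).2).choose_spec]
    simp
  map_mul' x y := toQ_injective <| by
    rw [(mem_completeIntClosure_B.1 (x * y).2).choose_spec, map_mul,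
      (mem_completeIntClosure_B.1 x.2).choose_spec, (mem_completeIntClosure_B.1 y.2).choose_spec,
      Submonoid.coe_mul, map_mul]

theorem toQ_closureEmbedding (x : completeIntClosure (B G₀)) :
    toQ (Free G₀) (closureEmbedding G₀ x) = mapQ (B G₀).subtype x :=
  (mem_completeIntClosure_B.1 x.2).choose_spec

theorem closureEmbedding_injective : Function.Injective (closureEmbedding G₀) := by
  intro x y h
  refine Subtype.ext (mapQ_injective (φ := (B G₀).subtype) Subtype.val_injective ?_)
  rw [← toQ_closureEmbedding, ← toQ_closureEmbedding, h]

/-- The inclusion of a monoid into its complete integral closure. -/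
noncomputable def toClosure (H : Type u) [CommMonoid H] : H →* completeIntClosure H :=
  (toQ H).codRestrict _ fun a => imageQ_le_completeIntClosure (toQ_mem_imageQ a)

@[simp]
theorem closureEmbedding_toClosure (S : B G₀) :
    closureEmbedding G₀ (toClosure (B G₀) S) = S :=
  toQ_injective (by
    rw [toQ_closureEmbedding]
    exact mapQ_toQ _ _)

theorem isCofinalHom_closureEmbedding : IsCofinalHom (closureEmbedding G₀) := by
  intro S
  obtain ⟨T, hT⟩ := isCofinalHom_B S
  exact ⟨toClosure _ T, by rwa [closureEmbedding_toClosure]⟩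

theorem isDivisorHom_closureEmbedding : IsDivisorHom (closureEmbedding G₀) := by
  rintro x y ⟨S, hS⟩
  have hmap : mapQ (B G₀).subtype ((y : Q (B G₀)) / x) = toQ _ S := by
    rw [map_div, ← toQ_closureEmbedding, ← toQ_closureEmbedding, hS, map_mul,
      mul_div_cancel_left]
  refine ⟨⟨(y : Q (B G₀)) / x, mem_completeIntClosure_B.2 ⟨S, hmap.symm⟩⟩, Subtype.ext ?_⟩
  rw [Submonoid.coe_mul, mul_div_cancel]

theorem subQ_closureEmbedding : subQ (closureEmbedding G₀) = subQ (B G₀).subtype := by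
  refine le_antisymm ((Subgroup.closure_le _).2 ?_) ((Subgroup.closure_le _).2 ?_)
  · rintro _ ⟨x, rfl⟩
    exact mem_subQ.2 ⟨x, (toQ_closureEmbedding x).symm⟩
  · rintro _ ⟨S, rfl⟩
    have := toQ_mem_subQ (closureEmbedding G₀) (toClosure _ S)
    rwa [closureEmbedding_toClosure] at this

theorem fg_completeIntClosure_B : Monoid.FG (completeIntClosure (B G₀)) := by
  refine fg_of_forall_mult_le (φ := closureEmbedding G₀) closureEmbedding_injective
    (Nat.card G) fun a => or_iff_not_imp_left.2 fun ha => ?_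
  push Not at ha
  obtain ⟨p, hp⟩ := ha
  obtain ⟨T, hT⟩ := exists_eq_pow_mul hp.le
  let b : completeIntClosure (B G₀) := toClosure _ ⟨_, pow_card_mem_B (Free.of p)⟩
  have hb : closureEmbedding G₀ b = Free.of p ^ Nat.card G := closureEmbedding_toClosure _
  obtain ⟨c, hc⟩ := isDivisorHom_closureEmbedding b a ⟨T, by rw [hT, hb]⟩
  refine ⟨b, c, hc, fun h => ?_, fun h => ?_⟩
  · have := congrArg (mult p) hb
    simp [h] at this
    exact Nat.card_pos.ne this
  · have := congrArg (fun x => mult p (closureEmbedding G₀ x)) hc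
    simp [h, hb] at this
    omega

theorem isKrull_completeIntClosure_B : IsKrull (completeIntClosure (B G₀)) :=
  isKrull_of_isDivisorHom isDivisorHom_closureEmbedding

theorem tfae_isKrull_B :
    List.TFAE [IsKrull (B G₀), IsRootClosed (B G₀), IsSaturated (B G₀)] := by
  tfae_have 1 → 2 := fun h => rootClosure_eq_completeIntClosure_B.trans h.2
  tfae_have 2 → 3 := by
    intro h S T hST
    have hmem : toQ _ T / toQ _ S ∈ completeIntClosure (B G₀) := by
      rw [mem_completeIntClosure_B, map_div, mapQ_toQ, mapQ_toQ]
      exact toQ_div_mem_imageQ.2 hST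
    rw [← rootClosure_eq_completeIntClosure_B, h] at hmem
    exact toQ_div_mem_imageQ.1 hmem
  tfae_have 3 → 1 := fun h => isKrull_of_isDivisorHom h
  tfae_finish

end Sequences

/-! ### Comparison of divisor theories -/

section DivisorTheory

variable {H : Type u} [CommMonoid H] {P : Type*} {P' : Type*}

theorem dvd_iff_toAdd_le {S T : Free P} : S ∣ T ↔ S.toAdd ≤ T.toAdd := by
  classical
  rw [dvd_iff_mult, Multiset.le_iff_count]
  refine forall_congr' fun p => ?_
  unfold mult
  convert Iff.rfl

theorem exists_isGcdOf {X : Set (Free P)} (hX : X.Finite) (hne : X.Nonempty) :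
    ∃ d, IsGcdOf d X := by
  classical
  induction X, hX using Set.Finite.induction_on with
  | empty => exact absurd hne Set.not_nonempty_empty
  | @insert a X _ _ ih =>
    rcases X.eq_empty_or_nonempty with rfl | hX
    · exact ⟨a, by simp [IsGcdOf]⟩
    · obtain ⟨d, hd⟩ := ih hX
      refine ⟨Multiplicative.ofAdd (a.toAdd ⊓ d.toAdd), ?_, fun e he => ?_⟩
      · rintro x (rfl | hx)
        · exact dvd_iff_toAdd_le.2 inf_le_left
        · exact (dvd_iff_toAdd_le.2 inf_le_right).trans (hd.1 x hx)
      · refine dvd_iff_toAdd_le.2 (le_inf ?_ ?_)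
        · exact dvd_iff_toAdd_le.1 (he a (Set.mem_insert _ _))
        · exact dvd_iff_toAdd_le.1 (hd.2 e fun x hx => he x (Set.mem_insert_of_mem _ hx))

/-- In a free abelian monoid, greatest common divisors commute with multiplication. -/
theorem IsGcdOf.dvd_mul {d : Free P} {X : Set (Free P)} (hd : IsGcdOf d X) {c e : Free P}
    (h : ∀ x ∈ X, e ∣ c * x) : e ∣ c * d := by
  classical
  have hm : ∀ p, mult p (Multiplicative.ofAdd (e.toAdd - c.toAdd)) = mult p e - mult p c :=
    fun p => by simp [mult]
  have := hd.2 (Multiplicative.ofAdd (e.toAdd - c.toAdd)) fun x hx => dvd_iff_mult.2 fun p => by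
    have := dvd_iff_mult.1 (h x hx) p
    rw [mult_mul] at this
    rw [hm]
    omega
  refine dvd_iff_mult.2 fun p => ?_
  have := dvd_iff_mult.1 this p
  rw [hm] at this
  rw [mult_mul]
  omega

theorem IsGcdOf.image_mul {φ : H →* Free P} {d : Free P} {X : Set H} (hd : IsGcdOf d (φ '' X))
    (a : H) : IsGcdOf (d * φ a) (φ '' ((a * ·) '' X)) := by
  constructor
  · rintro _ ⟨_, ⟨x, hx, rfl⟩, rfl⟩
    rw [map_mul, mul_comm]
    exact mul_dvd_mul_left _ (hd.1 _ ⟨x, hx, rfl⟩)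
  · intro e he
    rw [mul_comm]
    refine hd.dvd_mul ?_
    rintro _ ⟨x, hx, rfl⟩
    rw [← map_mul]
    exact he _ ⟨_, ⟨x, hx, rfl⟩, rfl⟩

theorem isGcdOf_image_one (φ : H →* Free P) : IsGcdOf 1 (φ '' {1}) := by
  simp [IsGcdOf]

variable {φ : H →* Free P} {ψ : H →* Free P'}

/-- In a divisor theory, every divisor is the greatest common divisor of finitely many principal
divisors. -/
theorem IsDivisorTheory.exists_isGcdOf (hφ : IsDivisorTheory φ) (d : Free P) :
    ∃ X : Set H, X.Finite ∧ X.Nonempty ∧ IsGcdOf d (φ '' X) := by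
  induction d using free_induction with
  | one => exact ⟨{1}, Set.finite_singleton _, Set.singleton_nonempty _, isGcdOf_image_one φ⟩
  | of_mul p S ih =>
    obtain ⟨X, hXf, hXn, hX⟩ := hφ.2 p
    obtain ⟨Y, hYf, hYn, hY⟩ := ih
    refine ⟨Set.image2 (· * ·) X Y, hXf.image2 _ hYf, hXn.image2 hYn, ?_, fun e he => ?_⟩
    · rintro _ ⟨_, ⟨x, hx, y, hy, rfl⟩, rfl⟩
      rw [map_mul]
      exact mul_dvd_mul (hX.1 _ ⟨x, hx, rfl⟩) (hY.1 _ ⟨y, hy, rfl⟩)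
    · refine hY.dvd_mul ?_
      rintro _ ⟨y, hy, rfl⟩
      rw [mul_comm]
      refine hX.dvd_mul ?_
      rintro _ ⟨x, hx, rfl⟩
      rw [mul_comm, ← map_mul]
      exact he _ ⟨_, ⟨x, hx, y, hy, rfl⟩, rfl⟩

theorem IsDivisorTheory.isCofinalHom (hφ : IsDivisorTheory φ) : IsCofinalHom φ := by
  intro d
  obtain ⟨X, -, ⟨x, hx⟩, hX⟩ := hφ.exists_isGcdOf d
  exact ⟨x, hX.1 _ ⟨x, hx, rfl⟩⟩

/-- Whether the greatest common divisor of `φ(X)` divides `φ(h)` is decided inside `H`: it means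
that `h` lies in the `v`-ideal generated by `X`. -/
theorem IsDivisorTheory.dvd_map_iff (hφ : IsDivisorTheory φ) {d : Free P} {X : Set H}
    (hne : X.Nonempty) (hd : IsGcdOf d (φ '' X)) (h : H) :
    d ∣ φ h ↔ ∀ a b : H, (∀ x ∈ X, a ∣ b * x) → a ∣ b * h := by
  constructor
  · intro hdh a b hab
    refine hφ.1 _ _ ?_
    rw [map_mul]
    refine (hd.dvd_mul ?_).trans (mul_dvd_mul_left _ hdh)
    rintro _ ⟨x, hx, rfl⟩
    rw [← map_mul]
    exact map_dvd φ (hab x hx)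
  · intro hh
    -- Take a complement `e` of `d` in a principal divisor `φ a` and write it as a gcd of `φ(Y)`.
    obtain ⟨a, ha⟩ := hne
    obtain ⟨e, he⟩ := hd.1 _ ⟨a, ha, rfl⟩
    obtain ⟨Y, -, -, hY⟩ := hφ.exists_isGcdOf e
    have key : φ a ∣ φ h * e := by
      refine hY.dvd_mul ?_
      rintro _ ⟨y, hy, rfl⟩
      rw [mul_comm, ← map_mul]
      refine map_dvd φ (hh a y fun x hx => hφ.1 _ _ ?_)
      rw [he, map_mul, mul_comm]
      exact mul_dvd_mul (hY.1 _ ⟨y, hy, rfl⟩) (hd.1 _ ⟨x, hx, rfl⟩)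
    rw [he] at key
    refine dvd_iff_mult.2 fun p => ?_
    have := dvd_iff_mult.1 key p
    rw [mult_mul, mult_mul] at this
    omega

/-- Divisibility between greatest common divisors of the same sets is the same in any two divisor
theories. -/
theorem IsDivisorTheory.gcd_dvd_gcd_iff (hφ : IsDivisorTheory φ) (hψ : IsDivisorTheory ψ)
    {X Y : Set H} (hX : X.Nonempty) {d d' : Free P} {e e' : Free P'}
    (hd : IsGcdOf d (φ '' X)) (hd' : IsGcdOf d' (φ '' Y))
    (he : IsGcdOf e (ψ '' X)) (he' : IsGcdOf e' (ψ '' Y)) : d ∣ d' ↔ e ∣ e' := by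
  have h₁ : d ∣ d' ↔ ∀ y ∈ Y, d ∣ φ y :=
    ⟨fun h y hy => h.trans (hd'.1 _ ⟨y, hy, rfl⟩),
      fun h => hd'.2 _ (by rintro _ ⟨y, hy, rfl⟩; exact h y hy)⟩
  have h₂ : e ∣ e' ↔ ∀ y ∈ Y, e ∣ ψ y :=
    ⟨fun h y hy => h.trans (he'.1 _ ⟨y, hy, rfl⟩),
      fun h => he'.2 _ (by rintro _ ⟨y, hy, rfl⟩; exact h y hy)⟩
  rw [h₁, h₂]
  refine forall₂_congr fun y _ => ?_
  rw [hφ.dvd_map_iff hX hd, hψ.dvd_map_iff hX he]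

/-- Whether every class contains a prime divisor does not depend on the divisor theory. -/
theorem EveryClassContainsPrime.of_isDivisorTheory (h : EveryClassContainsPrime ψ)
    (hψ : IsDivisorTheory ψ) (hφ : IsDivisorTheory φ) : EveryClassContainsPrime φ := by
  intro c
  obtain ⟨d, rfl⟩ := toClass_surjective hφ.isCofinalHom c
  obtain ⟨X, hXf, hXn, hd⟩ := hφ.exists_isGcdOf d
  obtain ⟨e, he⟩ := exists_isGcdOf (hXf.image ψ) (hXn.image ψ)
  obtain ⟨p', hp'⟩ := h (toClass ψ e)
  obtain ⟨b, a, hab⟩ := toClass_eq_iff.1 hp'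
  obtain ⟨Y, hYf, hYn, hY⟩ := hψ.2 p'
  obtain ⟨q, hq⟩ := exists_isGcdOf (hYf.image φ) (hYn.image φ)
  -- `d` and `q` differ by principal divisors since `e` and `p'` do.
  have hdq : d * φ a = q * φ b := free_dvd_antisymm
    ((hφ.gcd_dvd_gcd_iff hψ (hXn.image _) (hd.image_mul a) (hq.image_mul b) (he.image_mul a)
      (hY.image_mul b)).2 hab.symm.dvd)
    ((hφ.gcd_dvd_gcd_iff hψ (hYn.image _) (hq.image_mul b) (hd.image_mul a) (hY.image_mul b)
      (he.image_mul a)).2 hab.dvd)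
  -- `q` corresponds to `p'` under the comparison of divisors, hence it is prime.
  have hq1 : q ≠ 1 := fun h1 => of_ne_one p' <| eq_one_of_dvd_one <|
    (hφ.gcd_dvd_gcd_iff hψ hYn hq (isGcdOf_image_one φ) hY (isGcdOf_image_one ψ)).1 h1.dvd
  obtain ⟨p, hp⟩ := exists_of_dvd hq1
  obtain ⟨Z, hZf, hZn, hZ⟩ := hφ.2 p
  obtain ⟨f, hf⟩ := exists_isGcdOf (hZf.image ψ) (hZn.image ψ)
  have hfp : f ∣ Free.of p' := (hφ.gcd_dvd_gcd_iff hψ hZn hZ hq hf hY).1 hp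
  have hf1 : f ≠ 1 := fun h1 => of_ne_one p <| eq_one_of_dvd_one <|
    (hφ.gcd_dvd_gcd_iff hψ hZn hZ (isGcdOf_image_one φ) hf (isGcdOf_image_one ψ)).2 h1.dvd
  obtain ⟨r, hr⟩ := exists_of_dvd hf1
  obtain rfl : r = p' := by
    by_contra hne
    exact of_dvd_iff.1 (hr.trans hfp) (mult_of_ne hne)
  have hqp : q = Free.of p := free_dvd_antisymm
    ((hφ.gcd_dvd_gcd_iff hψ hYn hq hZ hY hf).2 hr) hp
  exact ⟨p, by rw [← hqp]; exact (toClass_eq_iff.2 ⟨a, b, hdq⟩).symm⟩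

theorem isDivisorTheory_mulEquiv (e : H ≃* Free P) : IsDivisorTheory e.toMonoidHom := by
  refine ⟨fun a b h => ?_, fun p => ⟨{e.symm (Free.of p)}, Set.finite_singleton _,
    Set.singleton_nonempty _, ?_⟩⟩
  · simpa using map_dvd e.symm h
  · simp [IsGcdOf]

theorem everyClassContainsPrime_mulEquiv [Nonempty P] (e : H ≃* Free P) :
    EveryClassContainsPrime e.toMonoidHom := by
  have h1 : ∀ d : Free P, toClass e.toMonoidHom d = 1 := fun d => by
    simpa using toClass_map e.toMonoidHom (e.symm d)
  intro c
  obtain ⟨d, rfl⟩ := toClass_surjective (isDivisorTheory_mulEquiv e).isCofinalHom c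
  exact ⟨Classical.arbitrary P, by rw [h1, h1]⟩

theorem isFactorial_mulEquiv [IsCancelMul H] (e : H ≃* Free P) : IsFactorial H := by
  intro a ha
  obtain ⟨s, hs, hprod⟩ := isFactorial_free (e a) (by simpa using ha)
  refine ⟨s.map e.symm, fun q hq => ?_, ?_⟩
  · obtain ⟨p, hp, rfl⟩ := Multiset.mem_map.1 hq
    refine ⟨by simpa using (hs p hp).1, fun x y hxy => ?_⟩
    have := (hs p hp).2 (e x) (e y) (by simpa using map_dvd e hxy)
    refine this.imp (fun h => ?_) fun h => ?_ <;> simpa using map_dvd e.symm h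
  · rw [← map_multiset_prod, hprod, MulEquiv.symm_apply_apply]

end DivisorTheory

/-! ### The class group -/

section ClassGroup

variable {G : Type u} [Group G] {G₀ : Set G}

/-- The homomorphism from a free abelian monoid to a commutative monoid with given values on the
basis. -/
def freeLift {P : Type u} {M : Type v} [CommMonoid M] (f : P → M) : Free P →* M where
  toFun S := (S.toAdd.map f).prod
  map_one' := by simp
  map_mul' S T := by rw [toAdd_mul, Multiset.map_add, Multiset.prod_add]

@[simp]
theorem freeLift_of {P : Type u} {M : Type v} [CommMonoid M] (f : P → M) (p : P) :
    freeLift f (Free.of p) = f p := by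
  show (Multiset.map f {p}).prod = f p
  rw [Multiset.map_singleton, Multiset.prod_singleton]

variable (G₀) in
/-- The homomorphism from `F(G₀)` to the abelianization of `⟨G₀⟩` extending `g ↦ gG'`. -/
def toAbelianization : Free G₀ →* Abelianization (Subgroup.closure G₀) :=
  freeLift fun x => Abelianization.of ⟨x, Subgroup.subset_closure x.2⟩

theorem toAbelianization_eq {S : Free G₀} {g : G} (hg : g ∈ products S) :
    toAbelianization G₀ S = Abelianization.of ⟨g, products_subset_closure hg⟩ :=
  (map_products Abelianization.of hg).symm

variable (G₀) in
/-- The homomorphism `Φ : F(G₀)/B(G₀) → ⟨G₀⟩/G'`, with the target written as an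
abelianization. -/
noncomputable def classHom :
    ClassGroupHom (B G₀).subtype →* Abelianization (Subgroup.closure G₀) :=
  QuotientGroup.lift _ (Algebra.GrothendieckGroup.lift (toAbelianization G₀)) <| by
    refine (Subgroup.closure_le _).2 ?_
    rintro _ ⟨S, rfl⟩
    rw [SetLike.mem_coe, MonoidHom.mem_ker, lift_toQ, Submonoid.subtype_apply,
      toAbelianization_eq S.2]
    exact map_one Abelianization.of

theorem classHom_toClass (S : Free G₀) :
    classHom G₀ (toClass (B G₀).subtype S) = toAbelianization G₀ S :=
  lift_toQ _ S

theorem classHom_surjective : Function.Surjective (classHom G₀) := by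
  rw [← MonoidHom.range_eq_top, eq_top_iff]
  rintro x -
  obtain ⟨⟨g, hg⟩, rfl⟩ := QuotientGroup.mk_surjective x
  change Abelianization.of _ ∈ _
  induction hg using Subgroup.closure_induction with
  | mem g hg =>
    exact ⟨toClass _ (Free.of ⟨g, hg⟩), by
      rw [classHom_toClass, toAbelianization_eq (mem_products_of _)]⟩
  | one => exact one_mem _
  | mul g h hg hh ihg ihh => exact mul_mem ihg ihh
  | inv g hg ih => exact inv_mem ih

end ClassGroup

section Univ

variable {G : Type u} [Group G]

/-- The sequence over `G` with the single term `g`. -/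
def single (g : G) : Free (Set.univ : Set G) := Free.of ⟨g, Set.mem_univ g⟩

theorem mem_products_single (g : G) : g ∈ products (single g) := mem_products_of _

theorem mul_single_inv_mem_B {S : Free (Set.univ : Set G)} {g : G} (hg : g ∈ products S) :
    S * single g⁻¹ ∈ B Set.univ := by
  rw [mem_B, ← mul_inv_cancel g]
  exact mul_mem_products hg (mem_products_single _)

/-- A sequence over `G` lies in the class of each of its products. -/
theorem toClass_eq_toClass_single {S : Free (Set.univ : Set G)} {g : G} (hg : g ∈ products S) :
    toClass (B (Set.univ : Set G)).subtype S = toClass (B (Set.univ : Set G)).subtype (single g) :=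
  toClass_eq_iff.2 ⟨⟨_, mul_single_inv_mem_B (mem_products_single g)⟩, ⟨_, mul_single_inv_mem_B hg⟩,
    mul_left_comm _ _ _⟩

variable (G) in
/-- The homomorphism from `G` to `F(G)/B(G)` mapping `g` to its class. -/
def singleClass : G →* ClassGroupHom (B (Set.univ : Set G)).subtype where
  toFun g := toClass _ (single g)
  map_one' := by rw [← toClass_eq_toClass_single one_mem_products, map_one]
  map_mul' g h := by
    rw [← map_mul, toClass_eq_toClass_single
      (mul_mem_products (mem_products_single g) (mem_products_single h))]

/-- The inverse of `Φ` is induced by `g ↦ [g]`, which kills commutators as its target is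
abelian. -/
theorem classHom_bijective [Finite G] : Function.Bijective (classHom (Set.univ : Set G)) := by
  refine ⟨(injective_iff_map_eq_one _).2 fun c hc => ?_, classHom_surjective⟩
  obtain ⟨S, rfl⟩ := toClass_surjective isCofinalHom_B c
  obtain ⟨g, hg⟩ := products_nonempty S
  rw [classHom_toClass, toAbelianization_eq hg] at hc
  have := congrArg (Abelianization.lift ((singleClass G).comp (Subgroup.subtype _))) hc
  rw [Abelianization.lift_apply_of, map_one] at this
  rw [toClass_eq_toClass_single hg]
  exact this

theorem everyClassContainsPrime_closureEmbedding [Finite G] :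
    EveryClassContainsPrime (closureEmbedding (Set.univ : Set G)) := by
  intro c
  obtain ⟨S, rfl⟩ := toClass_surjective isCofinalHom_closureEmbedding c
  obtain ⟨g, hg⟩ := products_nonempty S
  obtain ⟨a, b, hab⟩ := toClass_eq_iff.1 (toClass_eq_toClass_single hg)
  exact ⟨⟨g, Set.mem_univ g⟩, toClass_eq_iff.2 ⟨toClosure _ b, toClosure _ a, by
    rw [closureEmbedding_toClosure, closureEmbedding_toClosure]
    exact hab.symm⟩⟩

/-! ### Divisor theories for the complete integral closure -/

/-- If `|G| ≥ 3`, then every `g` occurs with exponent one in a product-one sequence, namely in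
`g h (g h)⁻¹` where `h ≠ g` and `(g h)⁻¹ ≠ g`. -/
theorem exists_mem_B_mult_eq_one (hG : 2 < Nat.card G) (g : G) :
    ∃ U ∈ B (Set.univ : Set G), mult ⟨g, Set.mem_univ g⟩ U = 1 := by
  obtain ⟨h, hh⟩ : ∃ h, h ∉ ({g, (g * g)⁻¹} : Set G) := by
    by_contra! hall
    have := (Set.ncard_insert_le g {(g * g)⁻¹}).trans_eq (by rw [Set.ncard_singleton])
    rw [Set.eq_univ_of_forall hall, Set.ncard_univ] at this
    omega
  simp only [Set.mem_insert_iff, Set.mem_singleton_iff, not_or] at hh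
  refine ⟨_, mul_single_inv_mem_B
    (mul_mem_products (mem_products_single g) (mem_products_single h)), ?_⟩
  have hk : g ≠ (g * h)⁻¹ := fun hk => hh.2 <| by
    rw [eq_inv_iff_mul_eq_one, ← mul_assoc, mul_eq_one_iff_inv_eq] at hk
    exact hk.symm
  rw [mult_mul, mult_mul, single, single, single, mult_of_self,
    mult_of_ne (by simpa using Ne.symm hh.1), mult_of_ne (by simpa using hk)]

theorem isDivisorTheory_closureEmbedding [Finite G] (hG : Nat.card G ≠ 2) :
    IsDivisorTheory (closureEmbedding (Set.univ : Set G)) := by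
  refine ⟨isDivisorHom_closureEmbedding, fun g => ?_⟩
  obtain hG | hG : Nat.card G ≤ 1 ∨ 2 < Nat.card G := by omega
  · have := Finite.card_le_one_iff_subsingleton.1 hG
    have hg : Free.of g ∈ B Set.univ := by
      rw [← pow_one (Free.of g), of_pow_mem_B_iff]
      exact Subsingleton.elim _ _
    refine ⟨{toClosure _ ⟨_, hg⟩}, Set.finite_singleton _, Set.singleton_nonempty _, ?_⟩
    simp [IsGcdOf]
  · obtain ⟨U, hU, hgU⟩ := exists_mem_B_mult_eq_one hG g
    refine ⟨{toClosure _ ⟨_, pow_card_mem_B (Free.of g)⟩, toClosure _ ⟨U, hU⟩},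
      Set.toFinite _, Set.insert_nonempty _ _, ?_⟩
    rw [Set.image_pair, closureEmbedding_toClosure, closureEmbedding_toClosure]
    constructor
    · rintro _ (rfl | rfl)
      · exact dvd_pow_self _ Nat.card_pos.ne'
      · exact of_dvd_iff.2 (by rw [hgU]; exact one_ne_zero)
    · intro e he
      refine dvd_iff_mult.2 fun q => ?_
      rcases eq_or_ne q g with rfl | hq
      · have := dvd_iff_mult.1 (he U (by simp)) q
        rwa [hgU, ← mult_of_self q] at this
      · have := dvd_iff_mult.1 (he _ (Set.mem_insert _ _)) q
        rw [mult_pow, mult_of_ne hq, mul_zero] at this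
        rwa [mult_of_ne hq]

theorem exists_mult_eq {P : Type v} [Finite P] (f : P → ℕ) :
    ∃ S : Free P, ∀ p, mult p S = f p := by
  classical
  refine ⟨Multiplicative.ofAdd (Finsupp.toMultiset (Finsupp.equivFunOnFinite.symm f)),
    fun p => ?_⟩
  rw [mult, toAdd_ofAdd, Finsupp.count_toMultiset]
  rfl

/-- In a product-one sequence over a group of order at most two, the exponent of each `g` is
divisible by the order of `g`. -/
theorem orderOf_dvd_mult (hG : ∀ g h : G, g ≠ 1 → h ≠ 1 → g = h) {S : Free (Set.univ : Set G)}
    (hS : S ∈ B Set.univ) (g : (Set.univ : Set G)) : orderOf (g : G) ∣ mult g S := by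
  rcases eq_or_ne (g : G) 1 with h1 | h1
  · simp [h1]
  obtain ⟨l, hl, hl1⟩ := hS
  rw [orderOf_dvd_iff_pow_eq_one, ← hl1, ← ofAdd_toAdd S, ← hl]
  clear hl hl1
  induction l with
  | nil => simp [mult]
  | cons x l ih =>
    have hm : Multiplicative.ofAdd ((x :: l : List (Set.univ : Set G)) : Multiset _) =
        Free.of x * Multiplicative.ofAdd (l : Multiset (Set.univ : Set G)) := rfl
    rw [hm, mult_mul, pow_add, ih, List.map_cons, List.prod_cons]
    congr 1
    rcases eq_or_ne (x : G) 1 with hx | hx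
    · have : g ≠ x := fun h => h1 (h ▸ hx)
      rw [mult_of_ne this, hx, pow_zero]
    · obtain rfl : g = x := Subtype.ext (hG _ _ h1 hx)
      simp

/-- If `|G| ≤ 2`, then `B(G)` is free with basis the powers `g ^ ord(g)`. -/
theorem nonempty_mulEquiv_B [Finite G] (hG : Nat.card G ≤ 2) :
    Nonempty (B (Set.univ : Set G) ≃* Free (Set.univ : Set G)) := by
  have hG' : ∀ g h : G, g ≠ 1 → h ≠ 1 → g = h := by
    intro g h hg hh
    by_contra hne
    have h3 : ({1, g, h} : Set G).ncard = 3 :=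
      Set.ncard_eq_three.2 ⟨1, g, h, hg.symm, hh.symm, hne, rfl⟩
    have := Set.ncard_le_ncard (Set.subset_univ ({1, g, h} : Set G))
    rw [h3, Set.ncard_univ] at this
    omega
  let f : Free (Set.univ : Set G) →* B (Set.univ : Set G) := freeLift fun g =>
    ⟨Free.of g ^ orderOf (g : G), of_pow_mem_B_iff.2 (pow_orderOf_eq_one _)⟩
  have hf : ∀ S g, mult g (f S : Free (Set.univ : Set G)) = orderOf (g : G) * mult g S := by
    intro S g
    induction S using free_induction with
    | one => simp
    | of_mul p S ih =>
      rw [map_mul, Submonoid.coe_mul, mult_mul, ih, mult_mul, mul_add, freeLift_of, mult_pow]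
      rcases eq_or_ne g p with rfl | hne
      · rfl
      · rw [mult_of_ne hne, mul_zero, mul_zero]
  refine ⟨(MulEquiv.ofBijective f ⟨fun S T h => free_ext fun g => ?_, fun S => ?_⟩).symm⟩
  · have := congrArg (fun x : B (Set.univ : Set G) => mult g (x : Free (Set.univ : Set G))) h
    simp only [hf] at this
    exact Nat.eq_of_mul_eq_mul_left (orderOf_pos _) this
  · obtain ⟨T, hT⟩ := exists_mult_eq fun g : (Set.univ : Set G) =>
      mult g (S : Free (Set.univ : Set G)) / orderOf (g : G)
    refine ⟨T, Subtype.ext (free_ext fun g => ?_)⟩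
    rw [hf, hT, Nat.mul_div_cancel' (orderOf_dvd_mult hG' S.2 g)]

/-! ### Krull and factorial monoids of product-one sequences -/

theorem isSaturated_B_of_comm (hG : ∀ a b : G, a * b = b * a) :
    IsSaturated (B (Set.univ : Set G)) := by
  rintro S T ⟨R, hR⟩
  refine ⟨⟨R, ?_⟩, Subtype.ext hR⟩
  obtain ⟨g, hg⟩ := products_nonempty R
  have h1 : (1 : G) * g ∈ products (T : Free (Set.univ : Set G)) := by
    rw [Submonoid.subtype_apply, Submonoid.subtype_apply] at hR
    rw [hR]
    exact mul_mem_products S.2 hg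
  obtain ⟨l, hl, hlg⟩ := h1
  obtain ⟨m, hm, hm1⟩ := T.2
  have hperm : l.Perm m := Multiset.coe_eq_coe.1 (hl.trans hm.symm)
  have := (hperm.map Subtype.val).prod_eq' (List.pairwise_of_forall hG)
  rw [mem_B]
  rwa [← hm1, ← this, hlg, one_mul]

theorem eq_or_eq_of_mem_products {x y : G} {g : G} (hg : g ∈ products (single x * single y)) :
    g = x * y ∨ g = y * x := by
  obtain ⟨l, hl, rfl⟩ := hg
  have hl' : (l : Multiset (Set.univ : Set G)) =
      (([⟨x, Set.mem_univ x⟩, ⟨y, Set.mem_univ y⟩] : List (Set.univ : Set G)) : Multiset _) := hl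
  have hperm := (Multiset.coe_eq_coe.1 hl').map Subtype.val
  generalize l.map Subtype.val = m at hperm
  obtain ⟨a, b, rfl⟩ := List.length_eq_two.1 hperm.length_eq
  have ha : a = x ∨ a = y := by simpa using hperm.subset (List.mem_cons_self)
  rcases ha with rfl | rfl
  · have := List.perm_singleton.1 (hperm.cons_inv)
    simp_all
  · have := List.perm_singleton.1 ((hperm.trans (List.Perm.swap _ _ _)).cons_inv)
    simp_all

/-- The product-one sequences `a b (ba)⁻¹` and `(ab) b⁻¹ a⁻¹` have the common multiple
`(ab) (ba)⁻¹ · a a⁻¹ b b⁻¹`, so saturation forces `(ab) (ba)⁻¹` to be a product-one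
sequence. -/
theorem comm_of_isSaturated_B (h : IsSaturated (B (Set.univ : Set G))) (a b : G) :
    a * b = b * a := by
  have h₁ := mul_single_inv_mem_B
    (mul_mem_products (mem_products_single b) (mem_products_single a))
  have h₂ : single (a * b) * single b⁻¹ * single a⁻¹ ∈ B Set.univ := by
    refine mul_single_inv_mem_B ?_
    have := mul_mem_products (mem_products_single (a * b)) (mem_products_single b⁻¹)
    rwa [mul_inv_cancel_right] at this
  have h₃ := mul_mem (mul_single_inv_mem_B (mem_products_single a))
    (mul_single_inv_mem_B (mem_products_single b))
  have key : (single b * single a * single (b * a)⁻¹) *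
      (single (a * b) * single b⁻¹ * single a⁻¹) =
      (single a * single a⁻¹ * (single b * single b⁻¹)) *
        (single (a * b) * single (b * a)⁻¹) := by
    ac_rfl
  obtain ⟨R, hR⟩ := h ⟨_, h₃⟩ ⟨_, mul_mem h₁ h₂⟩ ⟨_, key⟩
  have hR' := congrArg Subtype.val hR
  rw [Submonoid.coe_mul] at hR'
  have hR2 : (R : Free (Set.univ : Set G)) = single (a * b) * single (b * a)⁻¹ :=
    mul_left_cancel (hR'.symm.trans key)
  have hmem := R.2
  rw [hR2, mem_B] at hmem
  rcases eq_or_eq_of_mem_products hmem with h1 | h1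
  · exact mul_inv_eq_one.1 h1.symm
  · exact (inv_mul_eq_one.1 h1.symm).symm

theorem isKrull_B_univ_iff [Finite G] : IsKrull (B (Set.univ : Set G)) ↔ ∀ a b : G, a * b = b * a :=
  (tfae_isKrull_B.out 0 2).trans ⟨comm_of_isSaturated_B, isSaturated_B_of_comm⟩

theorem IsPrimeElement.dvd_of_dvd_pow {H : Type u} [CommMonoid H] {p a : H}
    (hp : IsPrimeElement p) {n : ℕ} (h : p ∣ a ^ n) : p ∣ a := by
  induction n with
  | zero => exact absurd (isUnit_of_dvd_one (by simpa using h)) hp.1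
  | succ n ih =>
    rw [pow_succ] at h
    exact (hp.2 _ _ h).elim ih id

/-- If `|G| ≥ 3`, take `g ≠ 1` and a product-one sequence `U` in which `g` has exponent one.
A prime factor of `g ^ |G|` is a power of `g` with exponent at least two; it divides
`U ^ |G|` but not `U`. -/
theorem card_le_two_of_isFactorial [Finite G] (h : IsFactorial (B (Set.univ : Set G))) :
    Nat.card G ≤ 2 := by
  by_contra! hG
  have : Nontrivial G := Finite.one_lt_card_iff_nontrivial.1 (by omega)
  obtain ⟨g, hg⟩ := exists_ne (1 : G)
  obtain ⟨U, hU, hgU⟩ := exists_mem_B_mult_eq_one hG g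
  set γ : (Set.univ : Set G) := ⟨g, Set.mem_univ g⟩
  let a : B (Set.univ : Set G) := ⟨_, pow_card_mem_B (Free.of γ)⟩
  have hunit : ∀ x : B (Set.univ : Set G), IsUnit x → (x : Free (Set.univ : Set G)) = 1 :=
    fun x hx => isUnit_free_iff.1 (hx.map (B (Set.univ : Set G)).subtype)
  have ha1 : (a : Free (Set.univ : Set G)) ≠ 1 := fun h1 => by
    have := congrArg (mult γ) h1
    simp [a, Nat.card_pos.ne'] at this
  obtain ⟨s, hs, hprod⟩ := h a fun hu => ha1 (hunit a hu)
  obtain ⟨p, hps⟩ : ∃ p, p ∈ s := Multiset.exists_mem_of_ne_zero fun h0 => ha1 <| by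
    rw [← hprod, h0]
    simp
  have hp := hs p hps
  have hpa : p ∣ a := hprod ▸ Multiset.dvd_prod hps
  have hpow : (p : Free (Set.univ : Set G)) = Free.of γ ^ mult γ (p : Free (Set.univ : Set G)) := by
    have hdvd := dvd_iff_mult.1 (map_dvd (B (Set.univ : Set G)).subtype hpa)
    refine free_ext fun q => ?_
    rcases eq_or_ne q γ with rfl | hq
    · simp
    · have := hdvd q
      simp only [Submonoid.subtype_apply, a, mult_pow, mult_of_ne hq, mul_zero] at this
      simp only [mult_pow, mult_of_ne hq, mul_zero]
      omega
  have hpU : p ∣ ⟨U, hU⟩ := by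
    obtain ⟨R, hR⟩ := of_dvd_iff.2 (show mult γ U ≠ 0 by rw [hgU]; exact one_ne_zero)
    refine hp.dvd_of_dvd_pow (n := Nat.card G) (hpa.trans ⟨⟨_, pow_card_mem_B R⟩, ?_⟩)
    refine Subtype.ext ?_
    rw [Submonoid.coe_mul, SubmonoidClass.coe_pow]
    simp only [a, hR, mul_pow]
  have hle := dvd_iff_mult.1 (map_dvd (B (Set.univ : Set G)).subtype hpU) γ
  rw [Submonoid.subtype_apply, Submonoid.subtype_apply, hgU] at hle
  obtain h0 | h1 : mult γ (p : Free (Set.univ : Set G)) = 0 ∨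
      mult γ (p : Free (Set.univ : Set G)) = 1 := by omega
  · refine hp.1 ?_
    have : p = 1 := Subtype.ext (by rw [hpow, h0, pow_zero]; rfl)
    exact this ▸ isUnit_one
  · have hmem := p.2
    rw [hpow, h1, of_pow_mem_B_iff, pow_one] at hmem
    exact hg hmem

theorem isFactorial_B_univ_iff [Finite G] : IsFactorial (B (Set.univ : Set G)) ↔ Nat.card G ≤ 2 :=
  ⟨card_le_two_of_isFactorial, fun h => isFactorial_mulEquiv (nonempty_mulEquiv_B h).some⟩

/-- If `|G| = 2`, then `B(G)` is free, hence its own complete integral closure, and an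
isomorphism to a free abelian monoid is a divisor theory whose class group is trivial. -/
theorem exists_isDivisorTheory_everyClassContainsPrime [Finite G] :
    ∃ ψ : completeIntClosure (B (Set.univ : Set G)) →* Free (Set.univ : Set G),
      IsDivisorTheory ψ ∧ EveryClassContainsPrime ψ := by
  by_cases hG : Nat.card G = 2
  · obtain ⟨e⟩ := nonempty_mulEquiv_B hG.le
    have hK : IsKrull (B (Set.univ : Set G)) :=
      isKrull_of_isDivisorHom (isDivisorTheory_mulEquiv e).1
    have hbij : Function.Bijective (toClosure (B (Set.univ : Set G))) := by
      refine ⟨fun S T h => toQ_injective (congrArg Subtype.val h), fun x => ?_⟩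
      obtain ⟨S, hS⟩ := hK.2.le x.2
      exact ⟨S, Subtype.ext hS⟩
    let e' := (MulEquiv.ofBijective _ hbij).symm.trans e
    have : Nonempty (Set.univ : Set G) := ⟨⟨1, Set.mem_univ 1⟩⟩
    exact ⟨_, isDivisorTheory_mulEquiv e', everyClassContainsPrime_mulEquiv e'⟩
  · exact ⟨_, isDivisorTheory_closureEmbedding hG, everyClassContainsPrime_closureEmbedding⟩

end Univ

end ProductOne

theorem theorem3p2 {G : Type u} [Group G] [Finite G] (G₀ : Set G) :
    -- `B(G₀) ⊆ F(G₀)` is cofinal, and `B(G₀)` is a finitely generated C-monoid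
    (IsCofinalHom (B G₀).subtype ∧ Monoid.FG (B G₀) ∧ IsCMonoid (B G₀)) ∧
    -- root closure and complete integral closure agree and are a finitely generated Krull monoid
    (rootClosure (B G₀) = completeIntClosure (B G₀) ∧
      Monoid.FG (completeIntClosure (B G₀)) ∧
      IsKrull (completeIntClosure (B G₀))) ∧
    -- `j` is the embedding of the complete integral closure into `F(G₀)`
    (∃ j : completeIntClosure (B G₀) →* Free G₀,
      (∀ x, toQ (Free G₀) (j x) = mapQ (B G₀).subtype x) ∧ Function.Injective j ∧
      IsCofinalHom j ∧ IsDivisorHom j ∧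
      -- the class group `C(j)` is `F(G₀)/B(G₀)`
      subQ j = subQ (B G₀).subtype ∧
      classMonoid (B G₀).subtype = ⊤ ∧
      -- if `G₀ = G` and `|G| ≠ 2`, then `j` is a divisor theory
      (G₀ = Set.univ → Nat.card G ≠ 2 → IsDivisorTheory j)) ∧
    -- the epimorphism `Φ : F(G₀)/B(G₀) → ⟨G₀⟩/G'`
    (∃ Φ : ClassGroupHom (B G₀).subtype →*
        Subgroup.closure G₀ ⧸ commutator (Subgroup.closure G₀),
      (∀ S : Free G₀, ∀ g ∈ products S, ∃ hg : g ∈ Subgroup.closure G₀,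
        Φ (toClass (B G₀).subtype S) =
          QuotientGroup.mk' (commutator (Subgroup.closure G₀)) ⟨g, hg⟩) ∧
      Function.Surjective Φ ∧
      (G₀ = Set.univ → Function.Bijective Φ)) ∧
    -- if `G₀ = G`, every class of the (divisor) class group of the complete integral closure
    -- contains a prime divisor; this group is `C(φ)` for a divisor theory `φ`
    (G₀ = Set.univ →
      (∃ (P : Type u) (φ : completeIntClosure (B G₀) →* Free P), IsDivisorTheory φ) ∧
      ∀ (P : Type v) (φ : completeIntClosure (B G₀) →* Free P),
        IsDivisorTheory φ → EveryClassContainsPrime φ) ∧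
    -- Krull, root closed and saturated are equivalent for `B(G₀)`
    List.TFAE [IsKrull (B G₀), IsRootClosed (B G₀), IsSaturated (B G₀)] ∧
    -- `B(G)` is Krull if and only if `G` is abelian
    (IsKrull (B (Set.univ : Set G)) ↔ ∀ a b : G, a * b = b * a) ∧
    -- `B(G)` is factorial if and only if `|G| ≤ 2`
    (IsFactorial (B (Set.univ : Set G)) ↔ Nat.card G ≤ 2) := by
  refine ⟨⟨isCofinalHom_B, fg_B, isCMonoid_B⟩,
    ⟨rootClosure_eq_completeIntClosure_B, fg_completeIntClosure_B, isKrull_completeIntClosure_B⟩,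
    ⟨closureEmbedding G₀, toQ_closureEmbedding, closureEmbedding_injective,
      isCofinalHom_closureEmbedding, isDivisorHom_closureEmbedding, subQ_closureEmbedding,
      classMonoid_eq_top isCofinalHom_B, ?_⟩,
    ⟨classHom G₀, fun S g hg => ⟨products_subset_closure hg, ?_⟩, classHom_surjective, ?_⟩,
    ?_, tfae_isKrull_B, isKrull_B_univ_iff, isFactorial_B_univ_iff⟩
  · rintro rfl hG
    exact isDivisorTheory_closureEmbedding hG
  · exact (classHom_toClass S).trans (toAbelianization_eq hg)
  · rintro rfl
    exact classHom_bijective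
  · rintro rfl
    obtain ⟨ψ, hψ, hprime⟩ := exists_isDivisorTheory_everyClassContainsPrime (G := G)
    exact ⟨⟨_, ψ, hψ⟩, fun P φ hφ => hprime.of_isDivisorTheory hψ hφ⟩
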